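/- A *big-step semantics* $(C,R,\mathcal R)$ consists of a set $C$ of configurations, a set $R$ of results, and a set $\mathcal R$ of rules $\rho$, each given by a finite sequence of premises $j_1,\dots,j_n$ ($n\ge 0$) and a conclusion $c\Rightarrow r$, where judgements $j_k$ are of the form $c_k\Rightarrow r_k$ with $c_k\in C$, $r_k\in R$; for each $c\in C$ the number of premises of the rules whose conclusion has configuration $c$ is required to be bounded. *Divergence semantics.* Let $\mathcal R_\infty$ be the set of rules on judgements $c\Rightarrow w$, $w\in R\sqcup\{\infty\}$, obtained by adding to $\mathcal R$, for each $\rho\in\mathcal R$ as above and $1\le i\le n$, the rule with premises $j_1,\dots,j_{i-1},\,c_i\Rightarrow\infty$ and conclusion $c\Rightarrow\infty$. Let $\mathcal C_\infty$ be the set of coaxioms $c\Rightarrow\infty$ (no premises), $c\in C$. A judgement is *derivable in* $(\mathcal R_\infty,\mathcal C_\infty)$ if it belongs to the coinductive interpretation (largest consistent set) of the system of those rules of $\mathcal R_\infty$ whose conclusion belongs to the inductive interpretation of $\mathcal R_\infty\cup\mathcal C_\infty$; equivalently, if it has a possibly infinite derivation in $\mathcal R_\infty$ each of whose nodes has a well-founded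 derivation in $\mathcal R_\infty\cup\mathcal C_\infty$. *Partial evaluation.* Let $\mathcal R_?$ be the set of rules on judgements $c\Rightarrow u$, $u\in R\sqcup\{?\}$, obtained by adding to $\mathcal R$ the start rules $\mathrm{st}(c)$, with no premises and conclusion $c\Rightarrow{?}$, for $c\in C$, and the partial rules $\mathrm{pt}(\rho,i,u)$, with premises $j_1,\dots,j_{i-1},\,c_i\Rightarrow u$ and conclusion $c\Rightarrow{?}$, for $\rho\in\mathcal R$ as above, $1\le i\le n$ and $u\in R\sqcup\{?\}$. A *finite partial evaluation tree* is a finite ordered tree labelled by such judgements in which, at every node, the sequence of labels of the children and the label of the node are the premises and the conclusion of a rule of $\mathcal R_?$. For $\rho,\rho'\in\mathcal R$ having at least $i$ premises, write $\rho\sim_i\rho'$ if they have the same configuration in the conclusion, the same premises $1,\dots,i-1$, and the same configuration in the $i$-th premise. The one-step transition relation $\longrightarrow$ between finite partial evaluation trees is the least relation such that, for $\rho,\rho'\in\mathcal R$, with $c$ the configuration in the conclusion of $\rho$: 1. the single node $c\Rightarrow{?}$ steps to the single node $c\Rightarrow r$ if $\rho$ has no premises and conclusion $c\Rightarrow r$;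 2. the single node $c\Rightarrow{?}$ steps to the tree with root $c\Rightarrow{?}$ and the single child $c_1\Rightarrow{?}$ if $\rho$ has at least one premise and $c_1$ is the configuration of its first one; 3. a tree with root $c\Rightarrow{?}$ and immediate subtrees $\tau_1,\dots,\tau_i$, whose root is derived by $\mathrm{pt}(\rho,i,r)$ with $r\in R$, steps to the tree with root $c\Rightarrow r'$ and the same subtrees if $\rho'\sim_i\rho$, the $i$-th premise of $\rho'$ has result $r$, $\rho'$ has exactly $i$ premises, and its conclusion has result $r'$; 4. a tree with root $c\Rightarrow{?}$ and immediate subtrees $\tau_1,\dots,\tau_i$, whose root is derived by $\mathrm{pt}(\rho,i,r)$ with $r\in R$, steps to the tree with root $c\Rightarrow{?}$ and immediate subtrees $\tau_1,\dots,\tau_i$ and the single node $c'\Rightarrow{?}$ if $\rho'\sim_i\rho$, the $i$-th premise of $\rho'$ has result $r$, and $\rho'$ has an $(i+1)$-th premise, with configuration $c'$; 5. a tree with root $c\Rightarrow{?}$ and immediate subtrees $\tau_1,\dots,\tau_i$, whose root is derived by $\mathrm{pt}(\rho,i,?)$, steps to the tree with root $c\Rightarrow{?}$, derived by $\mathrm{pt}(\rho,i,u)$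 for some $u\in R\sqcup\{?\}$, and immediate subtrees $\tau_1,\dots,\tau_{i-1},\tau_i'$ if $\tau_i\longrightarrow\tau_i'$. **Statement.** For every big-step semantics $(C,R,\mathcal R)$ and every $c\in C$, the judgement $c\Rightarrow\infty$ is derivable in $(\mathcal R_\infty,\mathcal C_\infty)$ if and only if there is an infinite sequence $\tau_0\longrightarrow\tau_1\longrightarrow\tau_2\longrightarrow\cdots$ of finite partial evaluation trees such that $\tau_0$ is the tree with the single node $c\Rightarrow{?}$. -/

import Mathlib

universe u v

/-! ## Inference systems and corules -/

/-- An inference system on the universe `U` of judgements: a set of rules, each rule being a pair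
(set of premises, conclusion). -/
abbrev InferenceSystem (U : Type u) : Type u := Set (Set U × U)

namespace InferenceSystem

variable {U : Type u}

/-- Judgements having a well-founded proof tree. -/
inductive HasWFProof (I : InferenceSystem U) : U → Prop
  | mk (prem : Set U) (concl : U) (hrule : (prem, concl) ∈ I)
      (hprem : ∀ j ∈ prem, HasWFProof I j) : HasWFProof I concl

/-- The inductive interpretation. -/
def Ind (I : InferenceSystem U) : Set U := {j | I.HasWFProof j}

/-- A set is consistent if each element is the conclusion of a rule with all premises in
the set. -/
def IsConsistent (I : InferenceSystem U) (X : Set U) : Prop :=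
  ∀ j ∈ X, ∃ prem : Set U, (prem, j) ∈ I ∧ prem ⊆ X

/-- The coinductive interpretation: the largest consistent set. -/
def CoInd (I : InferenceSystem U) : Set U := ⋃₀ {X | I.IsConsistent X}

/-- The rules of `I` whose conclusion lies in `X`. -/
def restrict (I : InferenceSystem U) (X : Set U) : InferenceSystem U := {p ∈ I | p.2 ∈ X}

/-- The interpretation of the inference system with corules `(I, co)`. -/
def FlexCo (I co : InferenceSystem U) : Set U := (I.restrict (Ind (I ∪ co))).CoInd

end InferenceSystem

/-! ## Big-step semantics -/

/-- A big-step rule: a finite sequence of premises `c₁ ⇒ r₁, …, cₙ ⇒ rₙ` (a judgement being a pair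
of a configuration and a result) and a conclusion `conf ⇒ res`. -/
@[ext]
structure BigStepRule (C : Type u) (R : Type v) where
  premises : List (C × R)
  conf : C
  res : R

/-- The inference system obtained from a set of big-step rules by forgetting order and
multiplicity of the premises. -/
def BigStepRule.toInferenceSystem {C : Type u} {R : Type v} (rules : Set (BigStepRule C R)) :
    InferenceSystem (C × R) :=
  {p | ∃ ρ ∈ rules, p = ({j | j ∈ ρ.premises}, (ρ.conf, ρ.res))}

/-- A big-step semantics with configurations `C` and results `R`; the number of premises of the
rules for a given configuration is bounded. -/
structure BigStepSemantics (C : Type u) (R : Type v) where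
  rules : Set (BigStepRule C R)
  bounded_premises : ∀ c : C, ∃ b : ℕ, ∀ ρ ∈ rules, ρ.conf = c → ρ.premises.length ≤ b

/-! ## Divergence semantics with coaxioms -/

/-- Results extended with divergence `∞`. -/
inductive DivResult (R : Type v) : Type v
  | val (r : R)
  | div

/-- A rule, seen as a rule over extended results. -/
def BigStepRule.toDiv {C : Type u} {R : Type v} (ρ : BigStepRule C R) :
    BigStepRule C (DivResult R) where
  premises := ρ.premises.map fun j => (j.1, DivResult.val j.2)
  conf := ρ.conf
  res := DivResult.val ρ.res

/-- The divergence propagation rule for the (zero-based) premise index `i`: the premises before `i`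
are kept, the configuration of premise `i` diverges, the following premises are dropped, and the
conclusion diverges. -/
def BigStepRule.divProp {C : Type u} {R : Type v} (ρ : BigStepRule C R)
    (i : Fin ρ.premises.length) : BigStepRule C (DivResult R) where
  premises := ((ρ.premises.take i).map fun j => (j.1, DivResult.val j.2)) ++
    [((ρ.premises.get i).1, DivResult.div)]
  conf := ρ.conf
  res := DivResult.div

namespace BigStepSemantics

variable {C : Type u} {R : Type v}

/-- The extension of a big-step semantics with divergence propagation rules. -/
def withDivergence (S : BigStepSemantics C R) : BigStepSemantics C (DivResult R) where
  rules := {σ | ∃ ρ ∈ S.rules, σ = ρ.toDiv ∨ ∃ i, σ = ρ.divProp i}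
  bounded_premises := by
    intro c
    obtain ⟨b, hb⟩ := S.bounded_premises c
    refine ⟨b, ?_⟩
    rintro σ ⟨ρ, hρ, rfl | ⟨i, rfl⟩⟩ hc
    · simpa [BigStepRule.toDiv] using hb ρ hρ hc
    · have h1 := hb ρ hρ hc
      have h2 := i.2
      simp only [BigStepRule.divProp, List.length_append, List.length_map, List.length_take,
        List.length_singleton]
      omega

end BigStepSemantics

/-- The coaxioms for divergence: for each configuration `c`, the coaxiom with conclusion
`c ⇒ ∞`. -/
def divCoaxioms (C : Type u) (R : Type v) : InferenceSystem (C × DivResult R) :=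
  {p | ∃ c : C, p = (∅, (c, DivResult.div))}

/-- `c ⇒ r` is derivable in the divergence semantics with coaxioms. -/
def BigStepSemantics.DerivableDiv {C : Type u} {R : Type v} (S : BigStepSemantics C R)
    (c : C) (r : DivResult R) : Prop :=
  (c, r) ∈ InferenceSystem.FlexCo
    (BigStepRule.toInferenceSystem S.withDivergence.rules) (divCoaxioms C R)

/-! ## Partial evaluation -/

/-- Results extended with the unknown result `?` of an evaluation not completed yet. -/
inductive PartialResult (R : Type v) : Type v
  | val (r : R)
  | unknown

/-- A rule, seen as a rule over possibly unknown results. -/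
def BigStepRule.toPartial {C : Type u} {R : Type v} (ρ : BigStepRule C R) :
    BigStepRule C (PartialResult R) where
  premises := ρ.premises.map fun j => (j.1, PartialResult.val j.2)
  conf := ρ.conf
  res := PartialResult.val ρ.res

/-- The start rule of a configuration: the axiom `c ⇒ ?`. -/
def BigStepRule.start {C : Type u} (R : Type v) (c : C) : BigStepRule C (PartialResult R) where
  premises := []
  conf := c
  res := PartialResult.unknown

/-- The partial rule of `ρ`, the (zero-based) premise index `i`, and a possibly unknown
result `w`. -/
def BigStepRule.partialRule {C : Type u} {R : Type v} (ρ : BigStepRule C R)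
    (i : Fin ρ.premises.length) (w : PartialResult R) : BigStepRule C (PartialResult R) where
  premises := ((ρ.premises.take i).map fun j => (j.1, PartialResult.val j.2)) ++
    [((ρ.premises.get i).1, w)]
  conf := ρ.conf
  res := PartialResult.unknown

namespace BigStepSemantics

variable {C : Type u} {R : Type v}

/-- The extension of a big-step semantics with start rules and partial rules. -/
def withUnknown (S : BigStepSemantics C R) : BigStepSemantics C (PartialResult R) where
  rules := {σ | (∃ ρ ∈ S.rules, σ = ρ.toPartial) ∨ (∃ c : C, σ = BigStepRule.start R c) ∨
    ∃ ρ ∈ S.rules, ∃ i w, σ = ρ.partialRule i w}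
  bounded_premises := by
    intro c
    obtain ⟨b, hb⟩ := S.bounded_premises c
    refine ⟨b, ?_⟩
    rintro σ (⟨ρ, hρ, rfl⟩ | ⟨c', rfl⟩ | ⟨ρ, hρ, i, w, rfl⟩) hc
    · simpa [BigStepRule.toPartial] using hb ρ hρ hc
    · simp [BigStepRule.start]
    · have h1 := hb ρ hρ hc
      have h2 := i.2
      simp only [BigStepRule.partialRule, List.length_append, List.length_map, List.length_take,
        List.length_singleton]
      omega

end BigStepSemantics

/-- Finite ordered trees labelled in `L`. -/
inductive OrderedTree (L : Type u) : Type u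
  | node (label : L) (children : List (OrderedTree L))

namespace OrderedTree

/-- The label of the root. -/
def root {L : Type u} : OrderedTree L → L
  | node a _ => a

/-- The big-step rule read off at the root of a tree labelled by judgements: the premises are the
labels of the children, the conclusion is the label of the root. -/
def rootRule {C : Type u} {R : Type v} : OrderedTree (C × R) → BigStepRule C R
  | node a ts => ⟨ts.map root, a.1, a.2⟩

end OrderedTree

/-- A finite tree is an evaluation tree if the rule read off at each of its nodes is a rule of the
semantics. -/
inductive BigStepSemantics.IsEvalTree {C : Type u} {R : Type v} (S : BigStepSemantics C R) :
    OrderedTree (C × R) → Prop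
  | node (a : C × R) (ts : List (OrderedTree (C × R)))
      (hroot : (OrderedTree.node a ts).rootRule ∈ S.rules)
      (hsub : ∀ t ∈ ts, IsEvalTree S t) : IsEvalTree S (OrderedTree.node a ts)

/-- Equality of big-step rules up to the (zero-based) index `i`: same configuration in the
conclusion, same premises before `i`, same configuration in premise `i`. -/
def BigStepRule.EqUpTo {C : Type u} {R : Type v} (i : ℕ) (ρ ρ' : BigStepRule C R) : Prop :=
  ∃ (h : i < ρ.premises.length) (h' : i < ρ'.premises.length),
    ρ.conf = ρ'.conf ∧ ρ.premises.take i = ρ'.premises.take i ∧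
      (ρ.premises[i]).1 = (ρ'.premises[i]).1

namespace BigStepSemantics

variable {C : Type u} {R : Type v}

/-- The initial tree for `c`: a single node `c ⇒ ?`. -/
def initTree (R : Type v) (c : C) : OrderedTree (C × PartialResult R) :=
  OrderedTree.node (c, PartialResult.unknown) []

open OrderedTree in
/-- One step of incremental evaluation. A hypothesis `t.rootRule = σ` says that `σ` is the rule
applied at the root of `t`. -/
inductive Step (S : BigStepSemantics C R) :
    OrderedTree (C × PartialResult R) → OrderedTree (C × PartialResult R) → Prop
  /-- A start tree returns the result of a rule without premises. -/
  | tr1 (ρ : BigStepRule C R) (hρ : ρ ∈ S.rules) (h : ρ.premises.length = 0) :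
      Step S (initTree R ρ.conf) (node (ρ.conf, .val ρ.res) [])
  /-- A start tree starts the evaluation of the first premise of a rule. -/
  | tr2 (ρ : BigStepRule C R) (hρ : ρ ∈ S.rules) (h : 0 < ρ.premises.length) :
      Step S (initTree R ρ.conf)
        (node (ρ.conf, .unknown) [initTree R (ρ.premises[0]).1])
  /-- All premises of `ρ'` have been evaluated: return its result. -/
  | tr3 (ρ ρ' : BigStepRule C R) (hρ : ρ ∈ S.rules) (hρ' : ρ' ∈ S.rules)
      (i : Fin ρ.premises.length) (r : R) (ts : List (OrderedTree (C × PartialResult R)))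
      (hsrc : (node (ρ.conf, .unknown) ts).rootRule = ρ.partialRule i (.val r))
      (heq : ρ'.EqUpTo i ρ) (hi : (i : ℕ) < ρ'.premises.length)
      (hr : (ρ'.premises[(i : ℕ)]).2 = r)
      (hlen : ρ'.premises.length = i + 1) :
      Step S (node (ρ.conf, .unknown) ts) (node (ρ.conf, .val ρ'.res) ts)
  /-- The first premises of `ρ'` have been evaluated: start the evaluation of the next one. -/
  | tr4 (ρ ρ' : BigStepRule C R) (hρ : ρ ∈ S.rules) (hρ' : ρ' ∈ S.rules)
      (i : Fin ρ.premises.length) (r : R) (ts : List (OrderedTree (C × PartialResult R)))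
      (hsrc : (node (ρ.conf, .unknown) ts).rootRule = ρ.partialRule i (.val r))
      (heq : ρ'.EqUpTo i ρ) (hi : (i : ℕ) < ρ'.premises.length)
      (hr : (ρ'.premises[(i : ℕ)]).2 = r)
      (hnext : (i : ℕ) + 1 < ρ'.premises.length) :
      Step S (node (ρ.conf, .unknown) ts)
        (node (ρ.conf, .unknown) (ts ++ [initTree R (ρ'.premises[(i : ℕ) + 1]).1]))
  /-- Propagate a step of the last, incomplete, subtree. -/
  | tr5 (ρ : BigStepRule C R) (hρ : ρ ∈ S.rules) (i : Fin ρ.premises.length)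
      (w : PartialResult R) (ts : List (OrderedTree (C × PartialResult R)))
      (t t' : OrderedTree (C × PartialResult R))
      (hsrc : (node (ρ.conf, .unknown) (ts ++ [t])).rootRule = ρ.partialRule i .unknown)
      (htgt : (node (ρ.conf, .unknown) (ts ++ [t'])).rootRule = ρ.partialRule i w)
      (hstep : Step S t t') :
      Step S (node (ρ.conf, .unknown) (ts ++ [t])) (node (ρ.conf, .unknown) (ts ++ [t']))

/-- Finite partial evaluation trees. -/
def PartialEvalTree (S : BigStepSemantics C R) :=
  {t : OrderedTree (C × PartialResult R) // S.withUnknown.IsEvalTree t}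

/-- The initial partial evaluation tree for `c`, consisting of the single node `c ⇒ ?`. -/
def PartialEvalTree.init (S : BigStepSemantics C R) (c : C) : S.PartialEvalTree :=
  ⟨initTree R c, .node _ _ (Or.inr (Or.inl ⟨c, rfl⟩)) (by simp)⟩

/-- The one-step transition relation between finite partial evaluation trees. -/
def PartialEvalTree.Red {S : BigStepSemantics C R} (t t' : S.PartialEvalTree) : Prop :=
  S.Step t.1 t'.1

/-- There is an infinite sequence of transitions starting from `t`. -/
def PartialEvalTree.RedInf {S : BigStepSemantics C R} (t : S.PartialEvalTree) : Prop :=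
  ∃ s : ℕ → S.PartialEvalTree, s 0 = t ∧ ∀ n, (s n).Red (s (n + 1))

end BigStepSemantics

/-!
The proof compares two descriptions of the diverging configurations.

With `S.Eval c r` for "`c ⇒ r` has a well-founded derivation", the coaxioms only ever introduce
judgements `c ⇒ ∞`, and no rule with a proper result has a premise `c ⇒ ∞`. Hence the judgements
`c ⇒ r` allowed in an infinite derivation are exactly those with `S.Eval c r`, and `c ⇒ ∞` is
derivable iff `c` lies in the largest set `X` of configurations such that each `c ∈ X` has a
diverging premise in `X` (`HasDivergingPremise`): a rule `ρ` for `c` and an index `i` such that the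
premises of `ρ` before `i` evaluate and the configuration of premise `i` is in `X`. This is
`DerivableDiv.hasDivergingPremise` and `derivableDiv_of_postfixed`. On the other side, `c` has an
infinite incremental evaluation iff the initial tree of `c` is not accessible for the reversed
transition relation (`redInf_init_iff_not_acc`).

If `c ⇒ ∞` is derivable, the evaluable premises before `i` can be run to completion one after the
other, which leads in at least one step from the initial tree of `c` to a tree whose last subtree
is the initial tree of premise `i`. Steps of the last subtree are steps of the whole tree, so the
trees that have the initial tree of a diverging configuration at the end of their rightmost branch
(`DivergingTree`) can always make at least one step to such a tree (`DivergingTree.exists_transGen`).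

Conversely, the configurations whose initial tree is not accessible are postfixed: if the
initial trees of all possible next premises for `c` are accessible, then so is that of `c`, by
induction first on the number of children that may still be added at the root, which is finite
because the number of premises is bounded, and then on the accessibility of the last subtree
(`acc_node_append_singleton`).
-/

universe w₁ w₂

namespace BigStepSemantics

variable {C : Type w₁} {R : Type w₂} {S : BigStepSemantics C R}

open OrderedTree Relation

/-! ### Divergence as a largest postfixed set of configurations -/

/-- The judgement `c ⇒ r` has a well-founded derivation in the big-step semantics. -/
def Eval (S : BigStepSemantics C R) (c : C) (r : R) : Prop :=
  (BigStepRule.toInferenceSystem S.rules).HasWFProof (c, r)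

/-- Some rule for `c` has a premise whose configuration lies in `X`, all earlier premises of that
rule being derivable. -/
def HasDivergingPremise (S : BigStepSemantics C R) (X : Set C) (c : C) : Prop :=
  ∃ ρ ∈ S.rules, ρ.conf = c ∧ ∃ i : Fin ρ.premises.length,
    (∀ j ∈ ρ.premises.take i, S.Eval j.1 j.2) ∧ (ρ.premises.get i).1 ∈ X

theorem eval_of_rule {ρ : BigStepRule C R} (hρ : ρ ∈ S.rules)
    (h : ∀ j ∈ ρ.premises, S.Eval j.1 j.2) : S.Eval ρ.conf ρ.res :=
  .mk {j | j ∈ ρ.premises} _ ⟨ρ, hρ, rfl⟩ h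

/-- Coaxioms do not contribute to the derivation of proper results. -/
theorem eval_of_hasWFProof_union_divCoaxioms {j : C × DivResult R}
    (h : InferenceSystem.HasWFProof
      (BigStepRule.toInferenceSystem S.withDivergence.rules ∪ divCoaxioms C R) j) :
    ∀ c r, j = (c, .val r) → S.Eval c r := by
  induction h with
  | mk prem concl hrule hprem ih =>
    rintro c r rfl
    rcases hrule with ⟨σ, ⟨ρ, hρ, rfl | ⟨i, rfl⟩⟩, h⟩ | ⟨c', h⟩
    · simp only [BigStepRule.toDiv, Prod.mk.injEq, DivResult.val.injEq] at h
      obtain ⟨rfl, rfl, rfl⟩ := h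
      refine eval_of_rule hρ fun j hj => ih (j.1, .val j.2) ?_ _ _ rfl
      exact List.mem_map.2 ⟨j, hj, rfl⟩
    · simp [BigStepRule.divProp] at h
    · simp at h

theorem hasWFProof_union_divCoaxioms_of_eval {j : C × R}
    (h : (BigStepRule.toInferenceSystem S.rules).HasWFProof j) :
    InferenceSystem.HasWFProof
      (BigStepRule.toInferenceSystem S.withDivergence.rules ∪ divCoaxioms C R)
      (j.1, .val j.2) := by
  induction h with
  | mk prem concl hrule hprem ih =>
    obtain ⟨ρ, hρ, h⟩ := hrule
    obtain ⟨rfl, rfl⟩ := Prod.mk.inj h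
    refine .mk {j | j ∈ ρ.toDiv.premises} _ (Or.inl ⟨ρ.toDiv, ⟨ρ, hρ, Or.inl rfl⟩, rfl⟩) ?_
    intro k hk
    obtain ⟨j, hj, rfl⟩ := List.mem_map.1 hk
    exact ih j hj

theorem DerivableDiv.eval {c : C} {r : R} (h : S.DerivableDiv c (.val r)) : S.Eval c r := by
  obtain ⟨X, hX, hc⟩ := h
  obtain ⟨prem, hrule, -⟩ := hX _ hc
  exact eval_of_hasWFProof_union_divCoaxioms hrule.2 _ _ rfl

theorem DerivableDiv.hasDivergingPremise {c : C} (h : S.DerivableDiv c .div) :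
    S.HasDivergingPremise {c | S.DerivableDiv c .div} c := by
  obtain ⟨X, hX, hc⟩ := h
  obtain ⟨prem, ⟨⟨σ, ⟨ρ, hρ, rfl | ⟨i, rfl⟩⟩, h⟩, -⟩, hprem⟩ := hX _ hc
  · simp [BigStepRule.toDiv] at h
  · obtain ⟨rfl, hcr⟩ := Prod.mk.inj h
    obtain ⟨rfl, -⟩ := Prod.mk.inj hcr
    refine ⟨ρ, hρ, rfl, i, fun j hj => DerivableDiv.eval ⟨X, hX, hprem ?_⟩, X, hX, hprem ?_⟩
    · exact List.mem_append_left _ (List.mem_map.2 ⟨j, hj, rfl⟩)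
    · exact List.mem_append_right _ (List.mem_singleton.2 rfl)

/-- Coinduction principle for divergence. -/
theorem derivableDiv_of_postfixed {X : Set C} (hX : ∀ c ∈ X, S.HasDivergingPremise X c)
    {c : C} (hc : c ∈ X) : S.DerivableDiv c .div := by
  -- The consistent set pairs the divergence of `X` with all derivable judgements.
  refine ⟨{j | (∃ c ∈ X, j = (c, .div)) ∨ ∃ c r, S.Eval c r ∧ j = (c, .val r)}, ?_,
    Or.inl ⟨c, hc, rfl⟩⟩
  rintro j (⟨c, hc, rfl⟩ | ⟨c, r, h, rfl⟩)
  · obtain ⟨ρ, hρ, rfl, i, hlt, hi⟩ := hX c hc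
    refine ⟨{j | j ∈ (ρ.divProp i).premises}, ⟨⟨ρ.divProp i, ⟨ρ, hρ, Or.inr ⟨i, rfl⟩⟩, rfl⟩, ?_⟩, ?_⟩
    · exact .mk ∅ _ (Or.inr ⟨_, rfl⟩) (by simp)
    · intro k hk
      rcases List.mem_append.1 hk with hk | hk
      · obtain ⟨j, hj, rfl⟩ := List.mem_map.1 hk
        exact Or.inr ⟨_, _, hlt j hj, rfl⟩
      · exact Or.inl ⟨_, hi, List.mem_singleton.1 hk⟩
  · have hwf := hasWFProof_union_divCoaxioms_of_eval h
    obtain ⟨prem, _, ⟨ρ, hρ, h⟩, hprem⟩ := h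
    obtain ⟨rfl, hcr⟩ := Prod.mk.inj h
    obtain ⟨rfl, rfl⟩ := Prod.mk.inj hcr
    refine ⟨{j | j ∈ ρ.toDiv.premises}, ⟨⟨ρ.toDiv, ⟨ρ, hρ, Or.inl rfl⟩, rfl⟩, hwf⟩, ?_⟩
    intro k hk
    obtain ⟨j, hj, rfl⟩ := List.mem_map.1 hk
    exact Or.inr ⟨_, _, hprem j hj, rfl⟩

/-! ### Partial evaluation trees and their steps -/

/-- A rule `ρ'` that agrees with `ρ` up to premise `i`, and whose premise `i` has the result found
by the evaluation, explains all the children of a root derived by a partial rule of `ρ`. -/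
theorem _root_.BigStepRule.EqUpTo.partialRule_premises {ρ ρ' : BigStepRule C R}
    {i : Fin ρ.premises.length} (heq : ρ'.EqUpTo i ρ) (hi : (i : ℕ) < ρ'.premises.length) :
    (ρ.partialRule i (.val (ρ'.premises[(i : ℕ)]).2)).premises =
      (ρ'.premises.take (i + 1)).map fun j => (j.1, PartialResult.val j.2) := by
  obtain ⟨_, _, _, htake, hget⟩ := heq
  rw [List.take_succ_eq_append_getElem hi, List.map_append, htake]
  simp [BigStepRule.partialRule, hget]

theorem Step.root_conf {t t' : OrderedTree (C × PartialResult R)} (h : S.Step t t') :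
    t'.root.1 = t.root.1 := by
  cases h <;> rfl

theorem Step.root_source {t t' : OrderedTree (C × PartialResult R)} (h : S.Step t t') :
    t.root.2 = .unknown := by
  cases h <;> rfl

theorem root_conf_of_reflTransGen {t t' : OrderedTree (C × PartialResult R)}
    (h : ReflTransGen S.Step t t') : t'.root.1 = t.root.1 := by
  induction h with
  | refl => rfl
  | tail _ h ih => exact h.root_conf.trans ih

theorem isEvalTree_initTree (c : C) : S.withUnknown.IsEvalTree (initTree R c) :=
  .node _ _ (Or.inr (Or.inl ⟨c, rfl⟩)) (by simp)

theorem Step.isEvalTree {t t' : OrderedTree (C × PartialResult R)} (h : S.Step t t')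
    (ht : S.withUnknown.IsEvalTree t) : S.withUnknown.IsEvalTree t' := by
  induction h with
  | tr1 ρ hρ h =>
    refine .node _ _ (Or.inl ⟨ρ, hρ, ?_⟩) (by simp)
    simp [rootRule, BigStepRule.toPartial, List.eq_nil_of_length_eq_zero h]
  | tr2 ρ hρ h =>
    refine .node _ _ (Or.inr (Or.inr ⟨ρ, hρ, ⟨0, h⟩, .unknown, ?_⟩)) ?_
    · simp [rootRule, BigStepRule.partialRule, initTree, root]
    · simpa using isEvalTree_initTree _
  | tr3 ρ ρ' hρ hρ' i r ts hsrc heq hi hr hlen =>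
    obtain ⟨_, _, _, hsub⟩ := ht
    refine .node _ _ (Or.inl ⟨ρ', hρ', ?_⟩) hsub
    subst hr
    have hprem := (congrArg BigStepRule.premises hsrc).trans (heq.partialRule_premises hi)
    rw [← hlen, List.take_length] at hprem
    exact BigStepRule.ext hprem heq.2.2.1.symm rfl
  | tr4 ρ ρ' hρ hρ' i r ts hsrc heq hi hr hnext =>
    obtain ⟨_, _, _, hsub⟩ := ht
    refine .node _ _ (Or.inr (Or.inr ⟨ρ', hρ', ⟨i + 1, hnext⟩, .unknown, ?_⟩)) ?_
    · subst hr
      have hprem := (congrArg BigStepRule.premises hsrc).trans (heq.partialRule_premises hi)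
      refine BigStepRule.ext ?_ heq.2.2.1.symm rfl
      simp only [rootRule] at hprem
      simp [rootRule, BigStepRule.partialRule, hprem, initTree, root]
    · intro t ht
      rcases List.mem_append.1 ht with ht | ht
      · exact hsub t ht
      · rw [List.mem_singleton.1 ht]
        exact isEvalTree_initTree _
  | tr5 ρ hρ i w ts t t' hsrc htgt hstep ih =>
    obtain ⟨_, _, _, hsub⟩ := ht
    refine .node _ _ (Or.inr (Or.inr ⟨ρ, hρ, i, w, htgt⟩)) fun u hu => ?_
    rcases List.mem_append.1 hu with hu | hu
    · exact hsub u (List.mem_append_left _ hu)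
    · rw [List.mem_singleton.1 hu]
      exact ih (hsub t (by simp))

/-- A partial evaluation tree with a proper result at the root is a derivation. -/
theorem eval_of_isEvalTree {t : OrderedTree (C × PartialResult R)}
    (ht : S.withUnknown.IsEvalTree t) : ∀ c r, t.root = (c, .val r) → S.Eval c r := by
  induction ht with
  | node a ts hroot hsub ih =>
    rintro c r rfl
    rcases hroot with ⟨ρ, hρ, h⟩ | ⟨c', h⟩ | ⟨ρ, hρ, i, w, h⟩
    · simp only [rootRule, BigStepRule.toPartial, BigStepRule.mk.injEq,
        PartialResult.val.injEq] at h
      obtain ⟨hts, rfl, rfl⟩ := h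
      refine eval_of_rule hρ fun j hj => ?_
      have hmem : (j.1, PartialResult.val j.2) ∈ ts.map root :=
        hts ▸ List.mem_map.2 ⟨j, hj, rfl⟩
      obtain ⟨u, hu, huj⟩ := List.mem_map.1 hmem
      exact ih u hu _ _ huj
    · simp [rootRule, BigStepRule.start] at h
    · simp [rootRule, BigStepRule.partialRule] at h

theorem redInf_init_iff_not_acc (c : C) :
    (PartialEvalTree.init S c).RedInf ↔ ¬ Acc (fun t' t => S.Step t t') (initTree R c) := by
  rw [not_acc_iff_exists_descending_chain]
  constructor
  · rintro ⟨s, h0, hs⟩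
    exact ⟨fun n => (s n).1, congrArg Subtype.val h0, hs⟩
  · rintro ⟨f, h0, hf⟩
    have hev : ∀ n, S.withUnknown.IsEvalTree (f n) := fun n => by
      induction n with
      | zero => exact h0 ▸ isEvalTree_initTree c
      | succ n ih => exact (hf n).isEvalTree ih
    exact ⟨fun n => ⟨f n, hev n⟩, Subtype.ext h0, hf⟩

/-! ### Divergence implies infinite incremental evaluation -/

theorem rootRule_node_append_singleton {ρ : BigStepRule C R} {i : Fin ρ.premises.length}
    {ts : List (OrderedTree (C × PartialResult R))}
    (hts : ts.map root = (ρ.premises.take i).map fun j => (j.1, .val j.2))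
    {t : OrderedTree (C × PartialResult R)} (ht : t.root.1 = (ρ.premises.get i).1) :
    (node (ρ.conf, .unknown) (ts ++ [t])).rootRule = ρ.partialRule i t.root.2 := by
  simp only [rootRule, BigStepRule.partialRule, List.map_append, List.map_cons, List.map_nil, hts,
    ← ht]

/-- Incremental evaluation of the last subtree is incremental evaluation of the whole tree. -/
theorem reflTransGen_node_append_singleton {ρ : BigStepRule C R} (hρ : ρ ∈ S.rules)
    {i : Fin ρ.premises.length} {ts : List (OrderedTree (C × PartialResult R))}
    (hts : ts.map root = (ρ.premises.take i).map fun j => (j.1, .val j.2))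
    {t t' : OrderedTree (C × PartialResult R)} (ht : t.root.1 = (ρ.premises.get i).1)
    (h : ReflTransGen S.Step t t') :
    ReflTransGen S.Step (node (ρ.conf, .unknown) (ts ++ [t]))
      (node (ρ.conf, .unknown) (ts ++ [t'])) := by
  induction h with
  | refl => exact .refl
  | @tail m t' hm hstep ih =>
    have hmc := (root_conf_of_reflTransGen hm).trans ht
    refine ih.tail (.tr5 ρ hρ i t'.root.2 ts m t' ?_
      (rootRule_node_append_singleton hts (hstep.root_conf.trans hmc)) hstep)
    rw [rootRule_node_append_singleton hts hmc, hstep.root_source]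

/-- Running the first `k` premises of a rule to completion reaches the start of premise `k`. -/
theorem exists_transGen_initTree_premise {ρ : BigStepRule C R} (hρ : ρ ∈ S.rules) (k : ℕ)
    (hk : k < ρ.premises.length)
    (h : ∀ j ∈ ρ.premises.take k, ∃ t, ReflTransGen S.Step (initTree R j.1) t ∧
      t.root = (j.1, .val j.2)) :
    ∃ ts : List (OrderedTree (C × PartialResult R)),
      ts.map root = ((ρ.premises.take k).map fun j => (j.1, .val j.2)) ∧
      TransGen S.Step (initTree R ρ.conf)
        (node (ρ.conf, .unknown) (ts ++ [initTree R (ρ.premises[k]).1])) := by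
  induction k with
  | zero => exact ⟨[], by simp, .single (.tr2 ρ hρ hk)⟩
  | succ k ih =>
    have hk' : k < ρ.premises.length := by omega
    rw [List.take_succ_eq_append_getElem hk'] at h
    obtain ⟨ts, hts, hred⟩ := ih hk' fun j hj => h j (List.mem_append_left _ hj)
    obtain ⟨t, ht, htr⟩ := h _ (List.mem_append_right _ (List.mem_singleton.2 rfl))
    refine ⟨ts ++ [t], ?_, ?_⟩
    · simp only [List.take_succ_eq_append_getElem hk', List.map_append, hts, List.map_cons,
        List.map_nil, htr]
    · have hlift := reflTransGen_node_append_singleton hρ (i := ⟨k, hk'⟩) hts rfl ht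
      refine (hred.trans_left hlift).tail
        (.tr4 ρ ρ hρ hρ ⟨k, hk'⟩ _ _ ?_ ⟨hk', hk', rfl, rfl, rfl⟩ hk' rfl hk)
      simp [rootRule, BigStepRule.partialRule, hts, htr]

/-- Incremental evaluation finds every derivable result. -/
theorem exists_reflTransGen_of_eval {j : C × R}
    (h : (BigStepRule.toInferenceSystem S.rules).HasWFProof j) :
    ∃ t, ReflTransGen S.Step (initTree R j.1) t ∧ t.root = (j.1, .val j.2) := by
  induction h with
  | mk prem concl hrule hprem ih =>
    obtain ⟨ρ, hρ, h⟩ := hrule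
    obtain ⟨rfl, rfl⟩ := Prod.mk.inj h
    rcases Nat.eq_zero_or_pos ρ.premises.length with h0 | hpos
    · exact ⟨_, .single (.tr1 ρ hρ h0), rfl⟩
    · obtain ⟨k, hk⟩ := Nat.exists_eq_add_of_le' hpos
      have hk' : k < ρ.premises.length := by omega
      obtain ⟨ts, hts, hred⟩ := exists_transGen_initTree_premise hρ k hk'
        fun j hj => ih j (List.mem_of_mem_take hj)
      obtain ⟨t, ht, htr⟩ := ih _ (List.getElem_mem hk')
      have hlift := reflTransGen_node_append_singleton hρ (i := ⟨k, hk'⟩) hts rfl ht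
      refine ⟨_, (hred.to_reflTransGen.trans hlift).tail
        (.tr3 ρ ρ hρ hρ ⟨k, hk'⟩ _ _ ?_ ⟨hk', hk', rfl, rfl, rfl⟩ hk' rfl hk), rfl⟩
      simp [rootRule, BigStepRule.partialRule, hts, htr]

/-- Trees whose rightmost branch ends in the initial tree of a diverging configuration, the other
subtrees along that branch being completely evaluated. -/
inductive DivergingTree (S : BigStepSemantics C R) : OrderedTree (C × PartialResult R) → Prop
  | init (c : C) (hc : S.DerivableDiv c .div) : DivergingTree S (initTree R c)
  | node (ρ : BigStepRule C R) (hρ : ρ ∈ S.rules) (i : Fin ρ.premises.length)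
      (ts : List (OrderedTree (C × PartialResult R))) (t : OrderedTree (C × PartialResult R))
      (hts : ts.map root = (ρ.premises.take i).map fun j => (j.1, .val j.2))
      (htc : t.root.1 = (ρ.premises.get i).1) (ht : DivergingTree S t) :
      DivergingTree S (node (ρ.conf, .unknown) (ts ++ [t]))

theorem DivergingTree.exists_transGen {t : OrderedTree (C × PartialResult R)}
    (h : S.DivergingTree t) : ∃ t', TransGen S.Step t t' ∧ S.DivergingTree t' := by
  induction h with
  | init c hc =>
    obtain ⟨ρ, hρ, rfl, i, hlt, hi⟩ := hc.hasDivergingPremise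
    obtain ⟨ts, hts, hred⟩ := exists_transGen_initTree_premise hρ i i.2
      fun j hj => exists_reflTransGen_of_eval (hlt j hj)
    exact ⟨_, hred, .node ρ hρ i ts _ hts rfl (.init _ hi)⟩
  | node ρ hρ i ts t hts htc ht ih =>
    obtain ⟨t', hred, ht'⟩ := ih
    have htc' := (root_conf_of_reflTransGen hred.to_reflTransGen).trans htc
    refine ⟨_, ?_, .node ρ hρ i ts t' hts htc' ht'⟩
    obtain ⟨m, hm, hmt⟩ := TransGen.head'_iff.1 hred
    have hmc := hm.root_conf.trans htc
    refine TransGen.head' (.tr5 ρ hρ i m.root.2 ts t m ?_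
      (rootRule_node_append_singleton hts hmc) hm)
      (reflTransGen_node_append_singleton hρ hts hmc hmt)
    rw [rootRule_node_append_singleton hts htc, hm.root_source]

theorem DivergingTree.not_acc {t : OrderedTree (C × PartialResult R)} (h : S.DivergingTree t) :
    ¬ Acc (fun t' t => S.Step t t') t := by
  intro hacc
  induction hacc.transGen with
  | intro t _ ih =>
    obtain ⟨t', hred, ht'⟩ := h.exists_transGen
    have hred' : TransGen (fun t' t => S.Step t t') t' t := transGen_swap.2 hred
    exact ih t' hred' ht' (hacc.inv_of_transGen hred')

/-! ### Infinite incremental evaluation implies divergence -/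

theorem acc_of_root_val {c : C} {r : R} {ts : List (OrderedTree (C × PartialResult R))} :
    Acc (fun t' t => S.Step t t') (node (c, .val r) ts) :=
  .intro _ fun _ h => by simpa [root] using h.root_source

/-- If the possible next premises for `c` all start a terminating evaluation, then a partial
evaluation of `c` whose last subtree terminates does so itself. The number `n` bounds how many
further children the root may get. -/
theorem acc_node_append_singleton {c : C}
    (hc : ¬ S.HasDivergingPremise {d | ¬ Acc (fun t' t => S.Step t t') (initTree R d)} c)
    {b : ℕ} (hb : ∀ σ ∈ S.withUnknown.rules, σ.conf = c → σ.premises.length ≤ b) (n : ℕ)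
    {ts : List (OrderedTree (C × PartialResult R))} {t : OrderedTree (C × PartialResult R)}
    (hn : b < ts.length + 1 + n)
    (hev : S.withUnknown.IsEvalTree (node (c, .unknown) (ts ++ [t])))
    (ht : Acc (fun t' t => S.Step t t') t) :
    Acc (fun t' t => S.Step t t') (node (c, .unknown) (ts ++ [t])) := by
  induction n generalizing ts t with
  | zero =>
    obtain ⟨_, _, hroot, _⟩ := hev
    have := hb _ hroot rfl
    simp only [rootRule, List.length_map, List.length_append, List.length_singleton] at this
    omega
  | succ n ihn =>
    induction ht with
    | intro t _ iht =>
      refine .intro _ fun s hstep => ?_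
      have hevs := hstep.isEvalTree hev
      generalize hu : node (c, .unknown) (ts ++ [t]) = u at hstep
      cases hstep with
      | tr1 => simp [initTree] at hu
      | tr2 => simp [initTree] at hu
      | tr3 => exact acc_of_root_val
      | tr4 ρ ρ' hρ hρ' i r us hsrc heq hi hr hnext =>
        simp only [node.injEq, Prod.mk.injEq, and_true] at hu
        obtain ⟨rfl, rfl⟩ := hu
        refine ihn (by simp only [List.length_append, List.length_singleton]; omega) hevs ?_
        by_contra hacc
        refine hc ⟨ρ', hρ', heq.2.2.1, ⟨i + 1, hnext⟩, fun j hj => ?_, hacc⟩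
        -- The evaluated children are derivations of the premises of `ρ'` up to index `i`.
        subst hr
        have hprem := (congrArg BigStepRule.premises hsrc).trans (heq.partialRule_premises hi)
        have hmem : (j.1, PartialResult.val j.2) ∈ (ts ++ [t]).map root :=
          (congrArg (_ ∈ ·) hprem).mpr (List.mem_map.2 ⟨j, hj, rfl⟩)
        obtain ⟨v, hv, hvj⟩ := List.mem_map.1 hmem
        obtain ⟨_, _, _, hsub⟩ := hev
        exact eval_of_isEvalTree (hsub v hv) _ _ hvj
      | tr5 ρ hρ i w us v v' hsrc htgt hstep =>
        simp only [node.injEq, Prod.mk.injEq, and_true] at hu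
        obtain ⟨rfl, hu⟩ := hu
        obtain ⟨rfl, htv⟩ := List.append_inj' hu rfl
        obtain rfl := List.singleton_inj.1 htv
        exact iht v' hstep hevs

theorem hasDivergingPremise_of_not_acc {c : C}
    (h : ¬ Acc (fun t' t => S.Step t t') (initTree R c)) :
    S.HasDivergingPremise {d | ¬ Acc (fun t' t => S.Step t t') (initTree R d)} c := by
  by_contra hc
  refine h (.intro _ fun s hstep => ?_)
  have hevs := hstep.isEvalTree (isEvalTree_initTree c)
  generalize hu : initTree R c = u at hstep
  cases hstep with
  | tr1 => exact acc_of_root_val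
  | tr2 ρ hρ hpos =>
    simp only [initTree, node.injEq, Prod.mk.injEq, and_true] at hu
    obtain rfl := hu
    obtain ⟨b, hb⟩ := S.withUnknown.bounded_premises ρ.conf
    refine acc_node_append_singleton hc hb b (ts := []) (by simp) hevs ?_
    by_contra hacc
    exact hc ⟨ρ, hρ, rfl, ⟨0, hpos⟩, by simp, hacc⟩
  | tr3 => exact acc_of_root_val
  -- The initial tree has no children, so no rule is partially applied at its root.
  | tr4 ρ ρ' hρ hρ' i r us hsrc =>
    simp only [initTree, node.injEq] at hu
    obtain ⟨_, rfl⟩ := hu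
    simp [rootRule, BigStepRule.partialRule] at hsrc
  | tr5 => simp [initTree] at hu

end BigStepSemantics

theorem mainTheorem6 {C : Type*} {R : Type*} (S : BigStepSemantics C R) (c : C) :
    S.DerivableDiv c DivResult.div ↔
      (BigStepSemantics.PartialEvalTree.init S c).RedInf := by
  rw [BigStepSemantics.redInf_init_iff_not_acc]
  exact ⟨fun h => (BigStepSemantics.DivergingTree.init c h).not_acc,
    BigStepSemantics.derivableDiv_of_postfixed
      (X := {d | ¬ Acc (fun t' t => S.Step t t') (BigStepSemantics.initTree R d)})
      fun _ => BigStepSemantics.hasDivergingPremise_of_not_acc⟩
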